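/- Let $X$ be a linearly ordered set with at least two elements. A clone on $X$ is a set of functions $X^m\to X$ (of arbitrary arities $m\ge 1$) that contains all projections and is closed under composition. A clone is minimal if it is a minimal element, with respect to inclusion, among the clones different from the trivial clone of all projections. A function is minimal if the smallest clone containing it is minimal. For $1\le k\le n$ let $m^n_k\colon X^n\to X$ be the function that returns the $k$-th smallest entry of an $n$-tuple, i.e. $m^n_k(x_1,\dots,x_n)=x_{j_k}$ if $x_{j_1}\le\dots\le x_{j_n}$ for a permutation $(j_1,\dots,j_n)$ of $(1,\dots,n)$. Let $n\ge 2$ and $1\le k\le n$. Then $m^n_k$ is minimal if and only if $k=1$, or $k=n$, or $n$ is odd and $k=\frac{n+1}{2}$. That is, $m^n_k$ is minimal if and only if it is the maximum function $\max_n$, the minimum function $\min_n$, or (with $n$ odd) the median function $\mathrm{med}_n=m^n_{(n+1)/2}$. -/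

import Mathlib

namespace OrderClone

/-- `𝒪⁽ⁿ⁾`: the `n`-ary functions on `X`. -/
abbrev Op (X : Type*) (n : ℕ) : Type _ := (Fin n → X) → X

/-- `𝒪 = ⋃_{n ≥ 1} 𝒪⁽ⁿ⁾`: all finitary functions on `X` of positive arity. -/
abbrev FinOp (X : Type*) : Type _ := Σ n : ℕ+, Op X (n : ℕ)

/-- A clone over `X`: a set of finitary functions that contains the projections and is
closed under composition. -/
@[ext]
structure Clone (X : Type*) where
  carrier : Set (FinOp X)
  proj_mem : ∀ (n : ℕ+) (i : Fin (n : ℕ)), (⟨n, fun x => x i⟩ : FinOp X) ∈ carrier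
  comp_mem : ∀ (n m : ℕ+) (f : Op X (n : ℕ)) (g : Fin (n : ℕ) → Op X (m : ℕ)),
    (⟨n, f⟩ : FinOp X) ∈ carrier → (∀ i, (⟨m, g i⟩ : FinOp X) ∈ carrier) →
      (⟨m, fun x => f (fun i => g i x)⟩ : FinOp X) ∈ carrier

/-- Clones are ordered by inclusion. -/
instance (X : Type*) : PartialOrder (Clone X) :=
  PartialOrder.lift Clone.carrier fun _ _ h => Clone.ext h

/-- The trivial clone `𝒥`, consisting of the projections only. -/
def trivialClone (X : Type*) : Clone X where
  carrier := {f | ∃ i : Fin (f.1 : ℕ), f.2 = fun x => x i}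
  proj_mem := fun _ i => ⟨i, rfl⟩
  comp_mem := by
    rintro n m f g ⟨i, hi⟩ hg
    obtain ⟨j, hj⟩ := hg i
    refine ⟨j, ?_⟩
    dsimp only at hi hj ⊢
    rw [hi]
    exact hj

/-- `⟨F⟩`: the clone generated by `F`, as the intersection of all clones that contain `F`. -/
def generate {X : Type*} (F : Set (FinOp X)) : Clone X where
  carrier := {f | ∀ C : Clone X, F ⊆ C.carrier → f ∈ C.carrier}
  proj_mem := fun n i C _ => C.proj_mem n i
  comp_mem := fun n m f g hf hg C hC => C.comp_mem n m f g (hf C hC) fun i => hg i C hC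

/-- `⟨F⟩` is the smallest clone containing `F`. -/
theorem isLeast_generate {X : Type*} (F : Set (FinOp X)) :
    IsLeast {C : Clone X | F ⊆ C.carrier} (generate F) :=
  ⟨fun _ hf _ hC => hC hf, fun C hC _ hf => hf C hC⟩

/-- A minimal clone: a minimal element of the set of all clones different from `𝒥`. -/
def IsMinimalClone {X : Type*} (C : Clone X) : Prop :=
  Minimal (fun D : Clone X => D ≠ trivialClone X) C

/-- A minimal function: one that generates a minimal clone. -/
def IsMinimalFunction {X : Type*} (f : FinOp X) : Prop :=
  IsMinimalClone (generate {f})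

section OrderStatistics

variable {X : Type*} [LinearOrder X]

/-- `m^n_k` for `1 ≤ k ≤ n`: the `k`-th smallest entry of an `n`-tuple. The index `k` is
counted from one, positions in a tuple are counted from zero. -/
def orderStat (n : ℕ+) (k : ℕ) (hk : 1 ≤ k ∧ k ≤ n) : Op X (n : ℕ) :=
  fun x => x (Tuple.sort x ⟨k - 1, by omega⟩)

/-- `m^n_k(x) = x_{j_k}` whenever `x_{j_1} ≤ ... ≤ x_{j_n}`. -/
theorem orderStat_eq (n : ℕ+) (k : ℕ) (hk : 1 ≤ k ∧ k ≤ n) (x : Fin (n : ℕ) → X)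
    (j : Equiv.Perm (Fin (n : ℕ))) (hj : Monotone (x ∘ j)) :
    orderStat n k hk x = x (j ⟨k - 1, by omega⟩) :=
  (congrFun (Tuple.comp_sort_eq_comp_iff_monotone.mpr hj) ⟨k - 1, by omega⟩).symm

/-- The maximum function in `n` variables. -/
def maxOp (n : ℕ+) : Op X (n : ℕ) :=
  fun x => Finset.univ.sup' Finset.univ_nonempty x

/-- The minimum function in `n` variables. -/
def minOp (n : ℕ+) : Op X (n : ℕ) :=
  fun x => Finset.univ.inf' Finset.univ_nonempty x

/-- The `n`-th median function, for odd `n`. -/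
def medOp (n : ℕ+) (hn : Odd (n : ℕ)) : Op X (n : ℕ) :=
  orderStat n (((n : ℕ) + 1) / 2) (by obtain ⟨r, hr⟩ := hn; omega)

end OrderStatistics

end OrderClone

/-! Every operation in the clone of m^n_k is determined by a predicate on upper level sets, so the
problem reduces to predicates on sets of coordinates; that of m^n_k is "at least n - k + 1
elements". If 2k ≤ n, the variables split into two blocks below this threshold. Identifying
variables within each block gives the binary minimum, hence `minOp n`. Minimality then puts m^n_k
into `infClone`, which forces k = 1. The case 2k ≥ n + 2 is dual. Conversely, a nontrivial member of
`infClone` again yields the binary minimum. If 2k = n + 1, the predicate is monotone and self-dual.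
A nontrivial g of this kind generates majorities (`exists_majority_mem`), and a monotone self-dual
predicate agrees with a projection on any two sets, so Baker–Pixley interpolation
(`exists_interpolation`) recovers m^n_k from g. -/

namespace OrderClone

/-- A function is described by a predicate `φ` on sets of coordinates when the upper level sets of
the function are computed by applying `φ` to the upper level sets of the coordinates. -/
def HasThreshold {X : Type*} [LinearOrder X] {n : ℕ} (f : Op X n) (φ : Set (Fin n) → Prop) :
    Prop :=
  ∀ x a, a ≤ f x ↔ φ {i | a ≤ x i}

/-! ### Generated clones and minimality -/

section Clone

variable {X : Type*}

theorem mem_generate_self (f : FinOp X) : f ∈ (generate {f}).carrier :=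
  fun _ hC => hC rfl

theorem generate_singleton_le {f : FinOp X} {C : Clone X} :
    generate {f} ≤ C ↔ f ∈ C.carrier :=
  ⟨fun h => h (mem_generate_self f), fun h => (isLeast_generate {f}).2 (by simpa using h)⟩

theorem trivialClone_le (C : Clone X) : trivialClone X ≤ C := by
  rintro ⟨n, f⟩ ⟨i, hi⟩
  rw [show f = fun x => x i from hi]
  exact C.proj_mem n i

theorem exists_notMem_trivialClone {C : Clone X} (hC : C ≠ trivialClone X) :
    ∃ f ∈ C.carrier, f ∉ (trivialClone X).carrier := by
  by_contra! h
  exact hC (le_antisymm h (trivialClone_le C))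

theorem generate_singleton_ne_trivialClone {f : FinOp X} (hf : f ∉ (trivialClone X).carrier) :
    generate {f} ≠ trivialClone X :=
  fun h => hf (h ▸ mem_generate_self f)

theorem isMinimalFunction_of_forall {f : FinOp X} (hf : f ∉ (trivialClone X).carrier)
    (h : ∀ g ∈ (generate {f}).carrier, g ∉ (trivialClone X).carrier →
      f ∈ (generate {g}).carrier) : IsMinimalFunction f := by
  refine ⟨generate_singleton_ne_trivialClone hf, fun D hD hDf => ?_⟩
  obtain ⟨g, hgD, hg⟩ := exists_notMem_trivialClone hD
  exact generate_singleton_le.2 (generate_singleton_le.2 hgD (h g (hDf hgD) hg))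

theorem IsMinimalFunction.mem_generate {f g : FinOp X} (hf : IsMinimalFunction f)
    (hgf : g ∈ (generate {f}).carrier) (hg : g ∉ (trivialClone X).carrier) :
    f ∈ (generate {g}).carrier :=
  hf.2 (generate_singleton_ne_trivialClone hg) (generate_singleton_le.2 hgf)
    (mem_generate_self f)

theorem Clone.ite_mem {C : Clone X} {n m : ℕ+} {f : Op X (n : ℕ)} {g h : Op X (m : ℕ)}
    (hf : ⟨n, f⟩ ∈ C.carrier) (hg : ⟨m, g⟩ ∈ C.carrier) (hh : ⟨m, h⟩ ∈ C.carrier)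
    (p : Fin (n : ℕ) → Prop) [DecidablePred p] :
    ⟨m, fun x => f (fun i => if p i then g x else h x)⟩ ∈ C.carrier := by
  have := C.comp_mem n m f (fun i => if p i then g else h) hf
    (fun i => by split_ifs <;> assumption)
  convert this using 5
  split_ifs <;> rfl

end Clone

/-! ### Threshold predicates; minima and maxima -/

section Threshold

variable {X : Type*} [LinearOrder X]

theorem HasThreshold.eq {n : ℕ} {f g : Op X n} {φ : Set (Fin n) → Prop}
    (hf : HasThreshold f φ) (hg : HasThreshold g φ) : f = g :=
  funext fun x => eq_of_forall_le_iff fun a => (hf x a).trans (hg x a).symm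

/-- Every set of coordinates is an upper level set of a two-valued tuple, so the function determines
its predicate. -/
theorem HasThreshold.iff [Nontrivial X] {n : ℕ} {f : Op X n} {φ ψ : Set (Fin n) → Prop}
    (hφ : HasThreshold f φ) (hψ : HasThreshold f ψ) (S : Set (Fin n)) : φ S ↔ ψ S := by
  classical
  obtain ⟨a, b, hab⟩ := exists_pair_lt X
  have hS : {i | b ≤ if i ∈ S then b else a} = S := by
    ext i
    by_cases hi : i ∈ S <;> simp [hi, hab]
  rw [← hS]
  exact (hφ (fun i => if i ∈ S then b else a) b).symm.trans (hψ _ b)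

theorem HasThreshold.congr {n : ℕ} {f : Op X n} {φ ψ : Set (Fin n) → Prop}
    (hf : HasThreshold f φ) (h : ∀ S, φ S ↔ ψ S) : HasThreshold f ψ :=
  fun x a => (hf x a).trans (h _)

theorem hasThreshold_proj {n : ℕ} (i : Fin n) :
    HasThreshold (fun x : Fin n → X => x i) (fun S => i ∈ S) :=
  fun _ _ => Iff.rfl

theorem HasThreshold.comp {n m : ℕ} {f : Op X n} {φ : Set (Fin n) → Prop}
    {g : Fin n → Op X m} {ψ : Fin n → Set (Fin m) → Prop}
    (hf : HasThreshold f φ) (hg : ∀ i, HasThreshold (g i) (ψ i)) :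
    HasThreshold (fun x => f (fun i => g i x)) (fun S => φ {i | ψ i S}) := by
  intro x a
  rw [hf]
  exact iff_of_eq (congrArg φ (Set.ext fun i => hg i x a))

theorem HasThreshold.mem_trivialClone {n : ℕ+} {f : Op X (n : ℕ)} {i : Fin (n : ℕ)}
    (hf : HasThreshold f (fun S => i ∈ S)) : (⟨n, f⟩ : FinOp X) ∈ (trivialClone X).carrier :=
  ⟨i, hf.eq (hasThreshold_proj i)⟩

/-- The clone of functions described by predicates from a class that contains the memberships and
is closed under composition. -/
def thresholdClone (X : Type*) [LinearOrder X] (P : ∀ n : ℕ, (Set (Fin n) → Prop) → Prop)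
    (hproj : ∀ n (i : Fin n), P n (fun S => i ∈ S))
    (hcomp : ∀ n m φ (ψ : Fin n → Set (Fin m) → Prop), P n φ → (∀ i, P m (ψ i)) →
      P m (fun S => φ {i | ψ i S})) : Clone X where
  carrier := {f | ∃ φ, P f.1 φ ∧ HasThreshold f.2 φ}
  proj_mem n i := ⟨_, hproj n i, hasThreshold_proj i⟩
  comp_mem := by
    rintro n m f g ⟨φ, hφ, hf⟩ hg
    choose ψ hψ hg using hg
    exact ⟨_, hcomp _ _ φ ψ hφ hψ, hf.comp hg⟩

/-- The clone of minima over nonempty sets of variables. -/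
def infClone (X : Type*) [LinearOrder X] : Clone X :=
  thresholdClone X (fun n φ => ∃ T : Set (Fin n), T.Nonempty ∧ ∀ S, φ S ↔ T ⊆ S)
    (fun _ i => ⟨{i}, by simp, by simp⟩) (by
      rintro n m φ ψ ⟨T, ⟨t, ht⟩, hφ⟩ hψ
      choose U hU hψ using hψ
      refine ⟨⋃ i ∈ T, U i, ?_, fun S => ?_⟩
      · obtain ⟨u, hu⟩ := hU t
        exact ⟨u, Set.mem_biUnion ht hu⟩
      · dsimp only
        rw [hφ, Set.iUnion₂_subset_iff]
        exact forall₂_congr fun i _ => hψ i S)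

/-- The clone of maxima over nonempty sets of variables. -/
def supClone (X : Type*) [LinearOrder X] : Clone X :=
  thresholdClone X (fun n φ => ∃ T : Set (Fin n), ∀ S, φ S ↔ (T ∩ S).Nonempty)
    (fun _ i => ⟨{i}, by simp⟩) (by
      rintro n m φ ψ ⟨T, hφ⟩ hψ
      choose U hψ using hψ
      refine ⟨⋃ i ∈ T, U i, fun S => ?_⟩
      dsimp only
      rw [hφ, Set.iUnion₂_inter]
      simp only [hψ, Set.nonempty_iUnion, exists_prop]
      rfl)

/-- The clone of functions described by monotone self-dual predicates. -/
def selfDualClone (X : Type*) [LinearOrder X] : Clone X :=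
  thresholdClone X (fun _ φ => Monotone φ ∧ ∀ S, φ Sᶜ ↔ ¬ φ S)
    (fun _ _ => ⟨fun _ _ h hS => h hS, fun _ => Iff.rfl⟩) (by
      rintro n m φ ψ ⟨hφ, hφc⟩ hψ
      refine ⟨fun S S' h => hφ fun i hi => (hψ i).1 h hi, fun S => ?_⟩
      rw [← hφc]
      exact iff_of_eq (congrArg φ (Set.ext fun i => (hψ i).2 S)))

theorem hasThreshold_minOp (n : ℕ+) :
    HasThreshold (minOp n : Op X (n : ℕ)) (fun S => Set.univ ⊆ S) := by
  intro x a
  simp [minOp, Set.subset_def]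

theorem hasThreshold_maxOp (n : ℕ+) :
    HasThreshold (maxOp n : Op X (n : ℕ)) (fun S => (Set.univ ∩ S).Nonempty) := by
  intro x a
  simp [maxOp, Set.Nonempty]

theorem minOp_mem_infClone (n : ℕ+) : (⟨n, minOp n⟩ : FinOp X) ∈ (infClone X).carrier :=
  ⟨_, ⟨Set.univ, Set.univ_nonempty, fun _ => Iff.rfl⟩, hasThreshold_minOp n⟩

theorem maxOp_mem_supClone (n : ℕ+) : (⟨n, maxOp n⟩ : FinOp X) ∈ (supClone X).carrier :=
  ⟨_, ⟨Set.univ, fun _ => Iff.rfl⟩, hasThreshold_maxOp n⟩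

theorem minOp_mem_of_inf_mem {C : Clone X} {n : ℕ+}
    (hC : ∀ f g : Op X (n : ℕ), ⟨n, f⟩ ∈ C.carrier → ⟨n, g⟩ ∈ C.carrier →
      ⟨n, fun x => f x ⊓ g x⟩ ∈ C.carrier) : ⟨n, minOp n⟩ ∈ C.carrier := by
  suffices ∀ (T : Finset (Fin (n : ℕ))) (hT : T.Nonempty),
      ⟨n, fun x => T.inf' hT x⟩ ∈ C.carrier from this _ _
  intro T hT
  induction hT using Finset.Nonempty.cons_induction with
  | singleton i => simpa using C.proj_mem n i
  | cons i T hi hT ih =>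
    simp only [Finset.inf'_cons hT]
    exact hC _ _ (C.proj_mem n i) ih

theorem maxOp_mem_of_sup_mem {C : Clone X} {n : ℕ+}
    (hC : ∀ f g : Op X (n : ℕ), ⟨n, f⟩ ∈ C.carrier → ⟨n, g⟩ ∈ C.carrier →
      ⟨n, fun x => f x ⊔ g x⟩ ∈ C.carrier) : ⟨n, maxOp n⟩ ∈ C.carrier :=
  -- Clones ignore the order, and reversing it exchanges minima and maxima.
  minOp_mem_of_inf_mem (X := Xᵒᵈ) (C := C) hC

/-- Substituting two functions for the variables inside and outside `A` yields their minimum. -/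
theorem inf_mem_of_hasThreshold {C : Clone X} {n m : ℕ+} {f : Op X (n : ℕ)}
    {φ : Set (Fin (n : ℕ)) → Prop} (hf : ⟨n, f⟩ ∈ C.carrier) (hφ : HasThreshold f φ)
    {A : Set (Fin (n : ℕ))} (huniv : φ Set.univ) (hempty : ¬ φ ∅) (hA : ¬ φ A) (hAc : ¬ φ Aᶜ)
    {g h : Op X (m : ℕ)} (hg : ⟨m, g⟩ ∈ C.carrier) (hh : ⟨m, h⟩ ∈ C.carrier) :
    ⟨m, fun x => g x ⊓ h x⟩ ∈ C.carrier := by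
  classical
  convert Clone.ite_mem hf hg hh (· ∈ A) using 3 with x
  refine eq_of_forall_le_iff fun a => ?_
  have key : {i | a ≤ if i ∈ A then g x else h x} =
      {i | if i ∈ A then a ≤ g x else a ≤ h x} := by
    ext i
    by_cases hi : i ∈ A <;> simp [hi]
  rw [hφ, key, le_inf_iff]
  by_cases h1 : a ≤ g x <;> by_cases h2 : a ≤ h x <;> simp [h1, h2]
  · exact huniv
  · exact hA
  · exact hAc
  · exact hempty

/-- Substituting two functions for the variables inside and outside `A` yields their maximum. -/
theorem sup_mem_of_hasThreshold {C : Clone X} {n m : ℕ+} {f : Op X (n : ℕ)}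
    {φ : Set (Fin (n : ℕ)) → Prop} (hf : ⟨n, f⟩ ∈ C.carrier) (hφ : HasThreshold f φ)
    {A : Set (Fin (n : ℕ))} (huniv : φ Set.univ) (hempty : ¬ φ ∅) (hA : φ A) (hAc : φ Aᶜ)
    {g h : Op X (m : ℕ)} (hg : ⟨m, g⟩ ∈ C.carrier) (hh : ⟨m, h⟩ ∈ C.carrier) :
    ⟨m, fun x => g x ⊔ h x⟩ ∈ C.carrier := by
  classical
  convert Clone.ite_mem hf hg hh (· ∈ A) using 3 with x
  refine eq_of_forall_le_iff fun a => ?_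
  have key : {i | a ≤ if i ∈ A then g x else h x} =
      {i | if i ∈ A then a ≤ g x else a ≤ h x} := by
    ext i
    by_cases hi : i ∈ A <;> simp [hi]
  rw [hφ, key, le_sup_iff]
  by_cases h1 : a ≤ g x <;> by_cases h2 : a ≤ h x <;> simp [h1, h2]
  · exact huniv
  · exact hA
  · exact hAc
  · exact hempty

/-- A nontrivial member is a minimum over a set `T` with at least two elements; `{i}` and its
complement, for `i ∈ T`, both fail to contain `T`. -/
theorem isMinimalFunction_minOp {n : ℕ+}
    (hn : (⟨n, minOp n⟩ : FinOp X) ∉ (trivialClone X).carrier) :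
    IsMinimalFunction (⟨n, minOp n⟩ : FinOp X) := by
  refine isMinimalFunction_of_forall hn ?_
  rintro ⟨m, g⟩ hg hgt
  obtain ⟨φ, ⟨T, ⟨i, hi⟩, hT⟩, hφ⟩ := generate_singleton_le.2 (minOp_mem_infClone n) hg
  obtain ⟨j, hj, hji⟩ : ∃ j ∈ T, j ≠ i := by
    by_contra! h
    have hTi : T = {i} := Set.eq_singleton_iff_unique_mem.2 ⟨hi, h⟩
    exact hgt (HasThreshold.mem_trivialClone (i := i) (hφ.congr fun S => by simp [hT, hTi]))
  refine minOp_mem_of_inf_mem fun _ _ => inf_mem_of_hasThreshold (mem_generate_self _) hφ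
    (A := {i}) ?_ ?_ ?_ ?_ <;> rw [hT]
  · exact Set.subset_univ T
  · exact fun h => h hi
  · exact fun h => hji (h hj)
  · exact fun h => h hi rfl

theorem isMinimalFunction_maxOp {n : ℕ+}
    (hn : (⟨n, maxOp n⟩ : FinOp X) ∉ (trivialClone X).carrier) :
    IsMinimalFunction (⟨n, maxOp n⟩ : FinOp X) :=
  isMinimalFunction_minOp (X := Xᵒᵈ) hn

end Threshold

/-! ### Self-dual predicates, majority and interpolation -/

section Majority

variable {X : Type*} [LinearOrder X]

/-- A non-projection described by a monotone self-dual predicate yields a majority operation. -/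
theorem exists_majority_mem {C : Clone X} {n m : ℕ+} {f : Op X (n : ℕ)}
    {φ : Set (Fin (n : ℕ)) → Prop} (hf : ⟨n, f⟩ ∈ C.carrier) (hφ : HasThreshold f φ)
    (hmono : Monotone φ) (hdual : ∀ S, φ Sᶜ ↔ ¬ φ S)
    (hft : (⟨n, f⟩ : FinOp X) ∉ (trivialClone X).carrier)
    {g₁ g₂ g₃ : Op X (m : ℕ)} {ψ₁ ψ₂ ψ₃ : Set (Fin (m : ℕ)) → Prop}
    (hg₁ : ⟨m, g₁⟩ ∈ C.carrier) (hg₂ : ⟨m, g₂⟩ ∈ C.carrier) (hg₃ : ⟨m, g₃⟩ ∈ C.carrier)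
    (hψ₁ : HasThreshold g₁ ψ₁) (hψ₂ : HasThreshold g₂ ψ₂) (hψ₃ : HasThreshold g₃ ψ₃) :
    ∃ g : Op X (m : ℕ), ⟨m, g⟩ ∈ C.carrier ∧
      HasThreshold g fun S => (ψ₁ S ∧ ψ₂ S) ∨ (ψ₁ S ∧ ψ₃ S) ∨ (ψ₂ S ∧ ψ₃ S) := by
  classical
  have huniv : φ Set.univ := by
    by_contra h
    exact h (hmono (Set.subset_univ _) ((hdual Set.univ).2 h))
  have hempty : ¬ φ ∅ := by rwa [← hdual, Set.compl_empty]
  -- The blocks `{i}`, `S \ {i}` and `Sᶜ` receive `g₁`, `g₂`, `g₃`. The union of any two satisfies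
  -- `φ`: it is `S`, or the complement of `S \ {i}` or of `{i}`.
  obtain ⟨S, hS⟩ := exists_minimal_of_wellFoundedLT φ ⟨_, huniv⟩
  obtain ⟨i, hi⟩ : S.Nonempty := Set.nonempty_iff_ne_empty.2 fun h => hempty (h ▸ hS.prop)
  have hsingle : ¬ φ {i} := by
    intro h
    refine hft (HasThreshold.mem_trivialClone (i := i)
      (hφ.congr fun U => ⟨fun hU => ?_, fun hU => ?_⟩))
    · by_contra hiU
      exact (hdual U).1 (hmono (by simpa using hiU) h) hU
    · exact hmono (by simpa using hU) h
  have hdiff : ¬ φ (S \ {i}) := fun h => (hS.le_of_le h Set.sdiff_subset hi).2 rfl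
  refine ⟨fun x => f fun j => if j = i then g₁ x else if j ∈ S then g₂ x else g₃ x, ?_, ?_⟩
  · convert C.comp_mem n m f (fun j => if j = i then g₁ else if j ∈ S then g₂ else g₃) hf
      (fun j => by split_ifs <;> assumption) using 5
    split_ifs <;> rfl
  intro x a
  have hpos : ∀ p q r : Prop, (p ∧ q) ∨ (p ∧ r) ∨ (q ∧ r) →
      φ {j | if j = i then p else if j ∈ S then q else r} := by
    rintro p q r (⟨hp, hq⟩ | ⟨hp, hr⟩ | ⟨hq, hr⟩)
    · refine hmono (fun j hj => ?_) hS.prop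
      simp [hp, hq, hj]
    · refine hmono (fun j hj => ?_) ((hdual _).2 hdiff)
      by_cases hji : j = i
      · simp [hji, hp]
      · have : j ∉ S := fun h => hj ⟨h, hji⟩
        simp [hji, this, hr]
    · refine hmono (fun j hj => ?_) ((hdual _).2 hsingle)
      have : j ≠ i := hj
      simp [this, hq, hr]
  have key : {j | a ≤ if j = i then g₁ x else if j ∈ S then g₂ x else g₃ x} =
      {j | if j = i then ψ₁ {l | a ≤ x l} else if j ∈ S then ψ₂ {l | a ≤ x l}
        else ψ₃ {l | a ≤ x l}} := by
    ext j
    simp only [Set.mem_ofPred_eq]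
    split_ifs
    exacts [hψ₁ x a, hψ₂ x a, hψ₃ x a]
  rw [hφ, key]
  refine ⟨fun h => ?_, hpos _ _ _⟩
  by_contra hmaj
  -- If the majority fails, it holds for the negations; self-duality then refutes `h`.
  refine (hdual _).1 ?_ h
  refine hmono (fun j hj => ?_) (hpos (¬ ψ₁ {l | a ≤ x l}) (¬ ψ₂ {l | a ≤ x l})
    (¬ ψ₃ {l | a ≤ x l}) (by tauto))
  simp only [Set.mem_ofPred_eq, Set.mem_compl_iff] at hj ⊢
  split_ifs at hj ⊢ <;> exact hj

/-- Two values of a monotone self-dual predicate are interpolated by a projection. -/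
theorem exists_mem_iff_of_selfDual {n : ℕ} {φ : Set (Fin n) → Prop} (hmono : Monotone φ)
    (hdual : ∀ S, φ Sᶜ ↔ ¬ φ S) (A B : Set (Fin n)) :
    ∃ i, (i ∈ A ↔ φ A) ∧ (i ∈ B ↔ φ B) := by
  have key : ∀ A B, φ A → φ B → (A ∩ B).Nonempty := by
    intro A B hA hB
    rw [← Set.not_disjoint_iff_nonempty_inter, ← Set.subset_compl_iff_disjoint_right]
    exact fun h => (hdual B).1 (hmono h hA) hB
  by_cases hA : φ A <;> by_cases hB : φ B
  · obtain ⟨i, hi⟩ := key A B hA hB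
    exact ⟨i, by simp_all⟩
  · obtain ⟨i, hi⟩ := key A Bᶜ hA ((hdual B).2 hB)
    exact ⟨i, by simp_all⟩
  · obtain ⟨i, hi⟩ := key Aᶜ B ((hdual A).2 hA) hB
    exact ⟨i, by simp_all⟩
  · obtain ⟨i, hi⟩ := key Aᶜ Bᶜ ((hdual A).2 hA) ((hdual B).2 hB)
    exact ⟨i, by simp_all⟩

/-- Interpolation on finitely many points by means of a majority operation. -/
theorem exists_interpolation {C : Clone X} {n : ℕ+} {φ : Set (Fin (n : ℕ)) → Prop}
    (hmono : Monotone φ) (hdual : ∀ S, φ Sᶜ ↔ ¬ φ S)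
    (hC : ∀ {g₁ g₂ g₃ : Op X (n : ℕ)} {ψ₁ ψ₂ ψ₃ : Set (Fin (n : ℕ)) → Prop},
      ⟨n, g₁⟩ ∈ C.carrier → ⟨n, g₂⟩ ∈ C.carrier → ⟨n, g₃⟩ ∈ C.carrier →
      HasThreshold g₁ ψ₁ → HasThreshold g₂ ψ₂ → HasThreshold g₃ ψ₃ →
      ∃ g : Op X (n : ℕ), ⟨n, g⟩ ∈ C.carrier ∧
        HasThreshold g fun S => (ψ₁ S ∧ ψ₂ S) ∨ (ψ₁ S ∧ ψ₃ S) ∨ (ψ₂ S ∧ ψ₃ S))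
    (F : Finset (Set (Fin (n : ℕ)))) :
    ∃ (g : Op X (n : ℕ)) (ψ : Set (Fin (n : ℕ)) → Prop),
      ⟨n, g⟩ ∈ C.carrier ∧ HasThreshold g ψ ∧ ∀ S ∈ F, ψ S ↔ φ S := by
  classical
  induction F using Finset.strongInduction with
  | H F ih =>
  by_cases hF : 2 < F.card
  · obtain ⟨A, hA, B, hB, D, hD, hAB, hAD, hBD⟩ := Finset.two_lt_card.1 hF
    obtain ⟨g₁, ψ₁, hg₁, hψ₁, h₁⟩ := ih _ (Finset.erase_ssubset hA)
    obtain ⟨g₂, ψ₂, hg₂, hψ₂, h₂⟩ := ih _ (Finset.erase_ssubset hB)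
    obtain ⟨g₃, ψ₃, hg₃, hψ₃, h₃⟩ := ih _ (Finset.erase_ssubset hD)
    obtain ⟨g, hg, hψ⟩ := hC hg₁ hg₂ hg₃ hψ₁ hψ₂ hψ₃
    refine ⟨g, _, hg, hψ, fun S hS => ?_⟩
    have e₁ : S ≠ A → (ψ₁ S ↔ φ S) := fun h => h₁ S (Finset.mem_erase.2 ⟨h, hS⟩)
    have e₂ : S ≠ B → (ψ₂ S ↔ φ S) := fun h => h₂ S (Finset.mem_erase.2 ⟨h, hS⟩)
    have e₃ : S ≠ D → (ψ₃ S ↔ φ S) := fun h => h₃ S (Finset.mem_erase.2 ⟨h, hS⟩)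
    by_cases hSA : S = A
    · rw [e₂ (hSA ▸ hAB), e₃ (hSA ▸ hAD)]
      by_cases hS : φ S <;> simp [hS]
    · rw [e₁ hSA]
      by_cases hSB : S = B
      · rw [e₃ (hSB ▸ hBD)]
        by_cases hS : φ S <;> simp [hS]
      · rw [e₂ hSB]
        by_cases hS : φ S <;> simp [hS]
  · obtain ⟨A, B, hAB⟩ : ∃ A B, ∀ S ∈ F, S = A ∨ S = B := by
      by_contra! h
      obtain ⟨A, hA, -⟩ := h ∅ ∅
      obtain ⟨B, hB, hBA, -⟩ := h A A
      obtain ⟨D, hD, hDA, hDB⟩ := h A B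
      exact hF (Finset.two_lt_card.2 ⟨A, hA, B, hB, D, hD, hBA.symm, hDA.symm, hDB.symm⟩)
    obtain ⟨i, hiA, hiB⟩ := exists_mem_iff_of_selfDual hmono hdual A B
    refine ⟨_, _, C.proj_mem n i, hasThreshold_proj i, fun S hS => ?_⟩
    rcases hAB S hS with rfl | rfl
    exacts [hiA, hiB]

theorem isMinimalFunction_of_selfDual {n : ℕ+} {f : Op X (n : ℕ)}
    (hft : (⟨n, f⟩ : FinOp X) ∉ (trivialClone X).carrier)
    (hf : (⟨n, f⟩ : FinOp X) ∈ (selfDualClone X).carrier) :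
    IsMinimalFunction (⟨n, f⟩ : FinOp X) := by
  refine isMinimalFunction_of_forall hft ?_
  rintro ⟨m, g⟩ hg hgt
  obtain ⟨ψ, ⟨hψm, hψd⟩, hψ⟩ := generate_singleton_le.2 hf hg
  obtain ⟨φ, ⟨hφm, hφd⟩, hφ⟩ := hf
  obtain ⟨f', φ', hf', hφ', h⟩ := exists_interpolation (C := generate {⟨m, g⟩}) hφm hφd
    (exists_majority_mem (mem_generate_self _) hψ hψm hψd hgt) (Set.toFinite Set.univ).toFinset
  have : f = f' := hφ.eq (hφ'.congr fun S => h S (by simp))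
  exact this ▸ hf'

end Majority

/-! ### Order statistics as cardinality thresholds -/

section OrderStatistics

variable {X : Type*} [LinearOrder X]

theorem ncard_setOf_val_lt {n c : ℕ} (hc : c ≤ n) : {i : Fin n | i.val < c}.ncard = c := by
  rw [Set.ncard_eq_toFinset_card']
  simp [Fin.card_filter_val_lt, hc]

/-- After sorting, the upper level set is a final segment; it contains position `k - 1` exactly when
it has more than `n - k` elements. -/
theorem hasThreshold_orderStat (n : ℕ+) (k : ℕ) (hk : 1 ≤ k ∧ k ≤ (n : ℕ)) :
    HasThreshold (orderStat n k hk : Op X (n : ℕ)) (fun S => (n : ℕ) < k + S.ncard) := by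
  intro x a
  have hmono : Monotone (x ∘ Tuple.sort x) := Tuple.monotone_sort x
  have hcard : {i | a ≤ x i}.ncard = {i | a ≤ x (Tuple.sort x i)}.ncard :=
    (Set.ncard_preimage_of_injective_subset_range (Tuple.sort x).injective (by simp)).symm
  have hpre := ncard_setOf_val_lt (n := n) (c := k - 1) (by omega)
  have hpre' := ncard_setOf_val_lt (n := n) (c := k) hk.2
  have hadd := Set.ncard_add_ncard_compl {i : Fin (n : ℕ) | i.val < k - 1}
  have hadd' := Set.ncard_add_ncard_compl {i : Fin (n : ℕ) | i.val < k}
  rw [Nat.card_eq_fintype_card, Fintype.card_fin] at hadd hadd'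
  dsimp only
  rw [hcard, orderStat]
  constructor
  · intro h
    have : {i : Fin (n : ℕ) | i.val < k - 1}ᶜ.ncard ≤
        {i | a ≤ x (Tuple.sort x i)}.ncard := by
      refine Set.ncard_le_ncard (fun i hi => h.trans (hmono ?_))
      simpa [Fin.le_def] using hi
    omega
  · intro h
    by_contra hlt
    have : {i | a ≤ x (Tuple.sort x i)}.ncard ≤ {i : Fin (n : ℕ) | i.val < k}ᶜ.ncard := by
      refine Set.ncard_le_ncard (fun i hi hik => hlt (le_trans hi (hmono ?_)))
      rw [Fin.le_def]
      exact Nat.le_sub_one_of_lt hik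
    omega

theorem orderStat_one (n : ℕ+) (hk : 1 ≤ 1 ∧ 1 ≤ (n : ℕ)) :
    (orderStat n 1 hk : Op X (n : ℕ)) = minOp n := by
  refine (hasThreshold_orderStat n 1 hk).eq ((hasThreshold_minOp n).congr fun S => ?_)
  have hadd := Set.ncard_add_ncard_compl S
  rw [Nat.card_eq_fintype_card, Fintype.card_fin] at hadd
  rw [Set.univ_subset_iff, ← Set.compl_empty_iff, ← Set.ncard_eq_zero]
  omega

theorem orderStat_self (n : ℕ+) (hk : 1 ≤ (n : ℕ) ∧ (n : ℕ) ≤ n) :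
    (orderStat n n hk : Op X (n : ℕ)) = maxOp n := by
  refine (hasThreshold_orderStat n n hk).eq ((hasThreshold_maxOp n).congr fun S => ?_)
  rw [Set.univ_inter, ← Set.ncard_pos]
  omega

theorem orderStat_inj [Nontrivial X] {n : ℕ+} {k l : ℕ} {hk : 1 ≤ k ∧ k ≤ (n : ℕ)}
    {hl : 1 ≤ l ∧ l ≤ (n : ℕ)} :
    (orderStat n k hk : Op X (n : ℕ)) = orderStat n l hl ↔ k = l := by
  refine ⟨fun h => ?_, fun h => by subst h; rfl⟩
  have key := (hasThreshold_orderStat n k hk).iff (h ▸ hasThreshold_orderStat (X := X) n l hl)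
  -- Sizes `n - k` and `n - l` are the largest that miss the respective thresholds.
  have h₁ := key {i | i.val < n - k}
  have h₂ := key {i | i.val < n - l}
  rw [ncard_setOf_val_lt (by omega)] at h₁ h₂
  omega

theorem orderStat_notMem_trivialClone [Nontrivial X] (n : ℕ+) (k : ℕ) (hn : 2 ≤ (n : ℕ))
    (hk : 1 ≤ k ∧ k ≤ (n : ℕ)) :
    (⟨n, orderStat n k hk⟩ : FinOp X) ∉ (trivialClone X).carrier := by
  rintro ⟨i, hi⟩
  dsimp only at hi
  have hstat := hasThreshold_orderStat (X := X) n k hk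
  rw [hi] at hstat
  have key := hstat.iff (hasThreshold_proj i)
  have : Nontrivial (Fin (n : ℕ)) := Fin.nontrivial_iff_two_le.2 hn
  obtain ⟨j, hj⟩ := exists_ne i
  have h₁ := key {i}
  have h₂ := key {j}
  simp [hj.symm] at h₁ h₂
  omega

theorem minOp_mem_generate_orderStat (n : ℕ+) (k : ℕ) (hk : 1 ≤ k ∧ k ≤ (n : ℕ))
    (h : 2 * k ≤ n) :
    (⟨n, minOp n⟩ : FinOp X) ∈ (generate {⟨n, orderStat n k hk⟩}).carrier := by
  have hA := ncard_setOf_val_lt hk.2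
  have hadd := Set.ncard_add_ncard_compl {i : Fin (n : ℕ) | i.val < k}
  rw [Nat.card_eq_fintype_card, Fintype.card_fin] at hadd
  -- The blocks have sizes `k` and `n - k`, both at most `n - k`.
  refine minOp_mem_of_inf_mem fun _ _ => inf_mem_of_hasThreshold (mem_generate_self _)
    (hasThreshold_orderStat n k hk) (A := {i | i.val < k}) ?_ ?_ ?_ ?_
  · simp [Set.ncard_univ]
    omega
  · simp
    omega
  all_goals omega

theorem maxOp_mem_generate_orderStat (n : ℕ+) (k : ℕ) (hk : 1 ≤ k ∧ k ≤ (n : ℕ))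
    (h : n + 2 ≤ 2 * k) :
    (⟨n, maxOp n⟩ : FinOp X) ∈ (generate {⟨n, orderStat n k hk⟩}).carrier := by
  have hA := ncard_setOf_val_lt (n := n) (c := k - 1) (by omega)
  have hadd := Set.ncard_add_ncard_compl {i : Fin (n : ℕ) | i.val < k - 1}
  rw [Nat.card_eq_fintype_card, Fintype.card_fin] at hadd
  -- The blocks have sizes `k - 1` and `n - k + 1`, both at least `n - k + 1`.
  refine maxOp_mem_of_sup_mem fun _ _ => sup_mem_of_hasThreshold (mem_generate_self _)
    (hasThreshold_orderStat n k hk) (A := {i | i.val < k - 1}) ?_ ?_ ?_ ?_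
  · simp [Set.ncard_univ]
    omega
  · simp
    omega
  all_goals omega

theorem eq_one_of_orderStat_mem_infClone [Nontrivial X] {n : ℕ+} {k : ℕ}
    {hk : 1 ≤ k ∧ k ≤ (n : ℕ)}
    (h : (⟨n, orderStat n k hk⟩ : FinOp X) ∈ (infClone X).carrier) : k = 1 := by
  obtain ⟨φ, ⟨T, ⟨i, hi⟩, hT⟩, hφ⟩ := h
  by_contra hk1
  have hadd := Set.ncard_add_ncard_compl ({i} : Set (Fin (n : ℕ)))
  rw [Nat.card_eq_fintype_card, Fintype.card_fin, Set.ncard_singleton] at hadd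
  have key := ((hasThreshold_orderStat n k hk).iff hφ {i}ᶜ).1 (by omega)
  exact (hT _).1 key hi rfl

theorem eq_self_of_orderStat_mem_supClone [Nontrivial X] {n : ℕ+} {k : ℕ}
    {hk : 1 ≤ k ∧ k ≤ (n : ℕ)}
    (h : (⟨n, orderStat n k hk⟩ : FinOp X) ∈ (supClone X).carrier) : k = n := by
  obtain ⟨φ, ⟨T, hT⟩, hφ⟩ := h
  have key := (hasThreshold_orderStat n k hk).iff hφ
  obtain ⟨i, hi, -⟩ := (hT _).1 ((key Set.univ).1 (by simp [Set.ncard_univ]; omega))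
  have := (key {i}).2 ((hT _).2 ⟨i, hi, rfl⟩)
  rw [Set.ncard_singleton] at this
  omega

/-- Here `n = 2k - 1` and the threshold is `k`, reached by exactly one of `S` and `Sᶜ`. -/
theorem orderStat_mem_selfDualClone {n : ℕ+} {k : ℕ} {hk : 1 ≤ k ∧ k ≤ (n : ℕ)}
    (h : 2 * k = n + 1) : (⟨n, orderStat n k hk⟩ : FinOp X) ∈ (selfDualClone X).carrier := by
  refine ⟨_, ⟨fun S S' hS hSk => ?_, fun S => ?_⟩, hasThreshold_orderStat n k hk⟩
  · exact lt_of_lt_of_le hSk (Nat.add_le_add_left (Set.ncard_le_ncard hS) k)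
  · have hadd := Set.ncard_add_ncard_compl S
    rw [Nat.card_eq_fintype_card, Fintype.card_fin] at hadd
    dsimp only at hadd ⊢
    omega

theorem isMinimalFunction_orderStat_iff [Nontrivial X] (n : ℕ+) (k : ℕ) (hn : 2 ≤ (n : ℕ))
    (hk : 1 ≤ k ∧ k ≤ (n : ℕ)) :
    IsMinimalFunction (⟨n, orderStat n k hk⟩ : FinOp X) ↔
      k = 1 ∨ k = (n : ℕ) ∨ (Odd (n : ℕ) ∧ k = ((n : ℕ) + 1) / 2) := by
  have hnt := fun k hk => orderStat_notMem_trivialClone (X := X) n k hn hk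
  have hmin := hnt 1 ⟨le_rfl, n.2⟩
  have hmax := hnt n ⟨n.2, le_rfl⟩
  rw [orderStat_one] at hmin
  rw [orderStat_self] at hmax
  constructor
  · intro h
    rcases lt_trichotomy (2 * k) (n + 1) with hlt | heq | hgt
    · left
      exact eq_one_of_orderStat_mem_infClone (generate_singleton_le.2 (minOp_mem_infClone n)
        (h.mem_generate (minOp_mem_generate_orderStat n k hk (by omega)) hmin))
    · exact Or.inr (Or.inr ⟨⟨k - 1, by omega⟩, by omega⟩)
    · right; left
      exact eq_self_of_orderStat_mem_supClone (generate_singleton_le.2 (maxOp_mem_supClone n)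
        (h.mem_generate (maxOp_mem_generate_orderStat n k hk (by omega)) hmax))
  · rintro (rfl | rfl | ⟨⟨r, hr⟩, hkr⟩)
    · rw [orderStat_one]
      exact isMinimalFunction_minOp hmin
    · rw [orderStat_self]
      exact isMinimalFunction_maxOp hmax
    · exact isMinimalFunction_of_selfDual (hnt k hk) (orderStat_mem_selfDualClone (by omega))

end OrderStatistics

end OrderClone

theorem mainTheorem2 {X : Type*} [LinearOrder X] [Nontrivial X]
    (n : ℕ+) (k : ℕ) (hn : 2 ≤ (n : ℕ)) (hk : 1 ≤ k ∧ k ≤ (n : ℕ)) :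
    (OrderClone.IsMinimalFunction
        (⟨n, OrderClone.orderStat n k hk⟩ : OrderClone.FinOp X) ↔
      k = 1 ∨ k = (n : ℕ) ∨ (Odd (n : ℕ) ∧ k = ((n : ℕ) + 1) / 2)) ∧
    (OrderClone.IsMinimalFunction
        (⟨n, OrderClone.orderStat n k hk⟩ : OrderClone.FinOp X) ↔
      (OrderClone.orderStat n k hk : OrderClone.Op X (n : ℕ)) = OrderClone.maxOp n ∨
      (OrderClone.orderStat n k hk : OrderClone.Op X (n : ℕ)) = OrderClone.minOp n ∨
      ∃ h : Odd (n : ℕ),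
        (OrderClone.orderStat n k hk : OrderClone.Op X (n : ℕ)) = OrderClone.medOp n h) := by
  have h := OrderClone.isMinimalFunction_orderStat_iff (X := X) n k hn hk
  refine ⟨h, h.trans ?_⟩
  rw [← OrderClone.orderStat_self n ⟨n.2, le_rfl⟩, ← OrderClone.orderStat_one n ⟨le_rfl, n.2⟩]
  simp only [OrderClone.medOp, OrderClone.orderStat_inj, exists_prop]
  tauto
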